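/- Let $E$ be a real Banach lattice and $E'$ its norm dual with the dual order. The following statements are equivalent. 1. $E$ has the weak Dunford–Pettis property: every weakly compact operator $T$ from $E$ into an arbitrary Banach space $Y$ is almost Dunford–Pettis, that is, $\|Tx_n\|\to 0$ for every disjoint weakly null sequence $(x_n)$ in $E$. 2. Every disjointly weakly compact subset of $E$ is an almost Dunford–Pettis set. 3. Every disjointly weakly compact subset of $E'$ is an almost $L$-set. Here a norm bounded subset $A$ of a Banach lattice $F$ is called *disjointly weakly compact* if every disjoint sequence in its solid hull $\{y\in F: |y|\le |x| \text{ for some } x\in A\}$ is weakly null. A norm bounded set $A\subseteq E$ is an *almost Dunford–Pettis set* if every disjoint weakly null sequence $(f_n)$ in $E'$ converges to zero uniformly on $A$, i.e. $\sup_{x\in A}|f_n(x)|\to 0$. A norm bounded set $B\subseteq E'$ is an *almost $L$-set* if every disjoint weakly null sequence $(x_n)$ in $E$ converges to zero uniformly on $B$, i.e. $\sup_{f\in B}|f(x_n)|\to 0$. A sequence $(x_n)$ is disjoint if $|x_m|\wedge|x_n|=0$ for $m\ne n$. -/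

import Mathlib

open Filter Topology

universe u v

/-!
A real Banach lattice `E` is given by the instances
`[NormedAddCommGroup E] [NormedSpace ℝ E] [CompleteSpace E] [Lattice E] [IsOrderedAddMonoid E]
[IsOrderedModule ℝ E] [HasSolidNorm E]`: a complete normed vector lattice with
`|x| ≤ |y| → ‖x‖ ≤ ‖y‖`.  Its dual is `StrongDual ℝ E` with the operator norm; the first section
equips it with the dual order and shows that it is again a Banach lattice.
-/

namespace BanachLattice

/-! ### The dual Banach lattice -/

section Dual

variable {E : Type*} [NormedAddCommGroup E] [NormedSpace ℝ E] [Lattice E]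

/-- The dual order: `f ≤ g` iff `f x ≤ g x` for every `x ≥ 0`. -/
instance dualLE : LE (StrongDual ℝ E) := ⟨fun f g => ∀ x : E, 0 ≤ x → f x ≤ g x⟩

theorem dual_le_def {f g : StrongDual ℝ E} : f ≤ g ↔ ∀ x : E, 0 ≤ x → f x ≤ g x := Iff.rfl

/-- The value at `x ≥ 0` of the positive part of `f`: the supremum of `f` on `[0, x]`. -/
noncomputable def posSup (f : StrongDual ℝ E) (x : E) : ℝ := sSup (f '' Set.Icc 0 x)

theorem posSup_le (f : StrongDual ℝ E) {x : E} (hx : 0 ≤ x) {r : ℝ}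
    (h : ∀ y, 0 ≤ y → y ≤ x → f y ≤ r) : posSup f x ≤ r := by
  refine csSup_le ⟨f 0, 0, ⟨le_rfl, hx⟩, rfl⟩ ?_
  rintro _ ⟨z, hz, rfl⟩
  exact h z hz.1 hz.2

variable [IsOrderedAddMonoid E]

theorem dual_eq_of_nonneg {f g : StrongDual ℝ E} (h : ∀ x : E, 0 ≤ x → f x = g x) : f = g := by
  ext x
  rw [← posPart_sub_negPart x, map_sub, map_sub, h _ (posPart_nonneg x), h _ (negPart_nonneg x)]

instance dualPartialOrder : PartialOrder (StrongDual ℝ E) where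
  toLE := dualLE
  le_refl _ _ _ := le_rfl
  le_trans _ _ _ h₁ h₂ x hx := (h₁ x hx).trans (h₂ x hx)
  le_antisymm _ _ h₁ h₂ := dual_eq_of_nonneg fun x hx => le_antisymm (h₁ x hx) (h₂ x hx)

instance dualIsOrderedAddMonoid : IsOrderedAddMonoid (StrongDual ℝ E) where
  add_le_add_left _ _ h c x hx := by
    simpa using h x hx

instance dualIsOrderedModule : IsOrderedModule ℝ (StrongDual ℝ E) where
  smul_le_smul_of_nonneg_left _ ha _ _ h x hx := by
    simpa using mul_le_mul_of_nonneg_left (h x hx) ha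
  smul_le_smul_of_nonneg_right _ hf _ _ h x hx := by
    simpa using mul_le_mul_of_nonneg_right h (hf x hx)

variable [HasSolidNorm E]

theorem apply_le_of_mem_Icc (f : StrongDual ℝ E) {x y : E} (hy : y ∈ Set.Icc 0 x) :
    f y ≤ ‖f‖ * ‖x‖ := by
  have hyx : ‖y‖ ≤ ‖x‖ := norm_le_norm_of_abs_le_abs (by
    rw [abs_of_nonneg hy.1, abs_of_nonneg (hy.1.trans hy.2)]; exact hy.2)
  calc f y ≤ ‖f y‖ := le_abs_self _
    _ ≤ ‖f‖ * ‖y‖ := f.le_opNorm y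
    _ ≤ ‖f‖ * ‖x‖ := by gcongr

theorem le_posSup (f : StrongDual ℝ E) {x y : E} (h0 : 0 ≤ y) (hy : y ≤ x) :
    f y ≤ posSup f x := by
  refine le_csSup ⟨‖f‖ * ‖x‖, ?_⟩ ⟨y, ⟨h0, hy⟩, rfl⟩
  rintro _ ⟨z, hz, rfl⟩
  exact apply_le_of_mem_Icc f hz

theorem posSup_nonneg (f : StrongDual ℝ E) {x : E} (hx : 0 ≤ x) : 0 ≤ posSup f x := by
  simpa using le_posSup f le_rfl hx

theorem posSup_le_norm (f : StrongDual ℝ E) {x : E} (hx : 0 ≤ x) : posSup f x ≤ ‖f‖ * ‖x‖ :=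
  posSup_le f hx fun _ h0 h1 => apply_le_of_mem_Icc f ⟨h0, h1⟩

theorem posSup_add (f : StrongDual ℝ E) {x y : E} (hx : 0 ≤ x) (hy : 0 ≤ y) :
    posSup f (x + y) = posSup f x + posSup f y := by
  refine le_antisymm (posSup_le f (add_nonneg hx hy) fun z h0 hz => ?_) ?_
  · have h1 : f (z ⊓ x) ≤ posSup f x := le_posSup f (le_inf h0 hx) inf_le_right
    have h2 : f (z - z ⊓ x) ≤ posSup f y := by
      refine le_posSup f (sub_nonneg.2 inf_le_left) ?_
      rw [sub_le_iff_le_add, ← sub_le_iff_le_add']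
      exact le_inf (sub_le_self _ hy) (sub_le_iff_le_add.2 hz)
    rw [map_sub] at h2
    linarith
  · have key : ∀ a, 0 ≤ a → a ≤ x → ∀ b, 0 ≤ b → b ≤ y → f a + f b ≤ posSup f (x + y) := by
      intro a ha hax b hb hby
      rw [← map_add]
      exact le_posSup f (add_nonneg ha hb) (add_le_add hax hby)
    have h1 : posSup f x ≤ posSup f (x + y) - posSup f y := by
      refine posSup_le f hx fun a ha hax => ?_
      have : posSup f y ≤ posSup f (x + y) - f a :=
        posSup_le f hy fun b hb hby => by linarith [key a ha hax b hb hby]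
      linarith
    linarith

/-- The positive part of `f` as an additive map on all of `E`. -/
noncomputable def dualPosAdd (f : StrongDual ℝ E) : E →+ ℝ :=
  AddMonoidHom.mk' (fun x => posSup f x⁺ - posSup f x⁻) (by
    intro x y
    have h : (x + y)⁺ + (x⁻ + y⁻) = (x⁺ + y⁺) + (x + y)⁻ := by
      have h1 := posPart_sub_negPart (x + y)
      have h2 := posPart_sub_negPart x
      have h3 := posPart_sub_negPart y
      have h4 : (x + y)⁺ - (x + y)⁻ = (x⁺ - x⁻) + (y⁺ - y⁻) := by rw [h1, h2, h3]
      rw [sub_eq_iff_eq_add] at h4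
      rw [h4]
      abel
    have h' := congrArg (posSup f) h
    rw [posSup_add f (posPart_nonneg _) (add_nonneg (negPart_nonneg _) (negPart_nonneg _)),
      posSup_add f (negPart_nonneg _) (negPart_nonneg _),
      posSup_add f (add_nonneg (posPart_nonneg _) (posPart_nonneg _)) (negPart_nonneg _),
      posSup_add f (posPart_nonneg _) (posPart_nonneg _)] at h'
    linarith)

theorem norm_dualPosAdd_le (f : StrongDual ℝ E) (x : E) : ‖dualPosAdd f x‖ ≤ ‖f‖ * ‖x‖ := by
  have hp : ‖x⁺‖ ≤ ‖x‖ := norm_le_norm_of_abs_le_abs (by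
    rw [abs_of_nonneg (posPart_nonneg x)]; exact sup_le (le_abs_self x) (abs_nonneg x))
  have hn : ‖x⁻‖ ≤ ‖x‖ := norm_le_norm_of_abs_le_abs (by
    rw [abs_of_nonneg (negPart_nonneg x)]; exact sup_le (neg_le_abs x) (abs_nonneg x))
  have h1 := (posSup_le_norm f (posPart_nonneg x)).trans
    (mul_le_mul_of_nonneg_left hp (norm_nonneg f))
  have h2 := (posSup_le_norm f (negPart_nonneg x)).trans
    (mul_le_mul_of_nonneg_left hn (norm_nonneg f))
  change |posSup f x⁺ - posSup f x⁻| ≤ _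
  rw [abs_le]
  constructor <;> linarith [posSup_nonneg f (posPart_nonneg x), posSup_nonneg f (negPart_nonneg x)]

/-- The positive part of `f` in the dual. -/
noncomputable def dualPos (f : StrongDual ℝ E) : StrongDual ℝ E :=
  (dualPosAdd f).toRealLinearMap
    (AddMonoidHomClass.continuous_of_bound (dualPosAdd f) ‖f‖ (norm_dualPosAdd_le f))

/-- The Riesz–Kantorovich formula: `f⁺ x = sup {f y | 0 ≤ y ≤ x}` for `x ≥ 0`. -/
theorem dualPos_apply (f : StrongDual ℝ E) {x : E} (hx : 0 ≤ x) : dualPos f x = posSup f x := by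
  have h0 : posSup f 0 = 0 := by
    refine le_antisymm (posSup_le f le_rfl fun y h0 h1 => ?_) (posSup_nonneg f le_rfl)
    rw [le_antisymm h1 h0, map_zero]
  change posSup f x⁺ - posSup f x⁻ = posSup f x
  rw [posPart_of_nonneg hx, negPart_of_nonneg hx, h0, sub_zero]

theorem le_dualPos (f : StrongDual ℝ E) : f ≤ dualPos f := fun x hx => by
  rw [dualPos_apply f hx]; exact le_posSup f hx le_rfl

theorem dualPos_nonneg (f : StrongDual ℝ E) : 0 ≤ dualPos f := fun x hx => by
  rw [dualPos_apply f hx]; exact posSup_nonneg f hx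

theorem dualPos_le {f g : StrongDual ℝ E} (h : f ≤ g) (hg : 0 ≤ g) : dualPos f ≤ g :=
  fun x hx => by
    rw [dualPos_apply f hx]
    refine posSup_le f hx fun y hy hyx => (h y hy).trans ?_
    have := hg (x - y) (sub_nonneg.2 hyx)
    rw [map_sub] at this
    simpa using this

/-- The dual of a normed vector lattice is a lattice in the dual order. -/
noncomputable instance dualLattice : Lattice (StrongDual ℝ E) where
  __ := dualPartialOrder
  sup f g := dualPos (f - g) + g
  inf f g := f - dualPos (f - g)
  le_sup_left f g := by
    rw [← sub_le_iff_le_add]; exact le_dualPos _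
  le_sup_right f g := le_add_of_nonneg_left (dualPos_nonneg _)
  sup_le f g k hf hg := by
    rw [← le_sub_iff_add_le]
    exact dualPos_le (sub_le_sub_right hf g) (sub_nonneg.2 hg)
  inf_le_left f g := sub_le_self _ (dualPos_nonneg _)
  inf_le_right f g := by
    rw [sub_le_comm]; exact le_dualPos _
  le_inf k f g hf hg := by
    rw [le_sub_comm]
    exact dualPos_le (sub_le_sub_left hg f) (sub_nonneg.2 hf)

theorem dual_abs_apply_le {f : StrongDual ℝ E} {x : E} {r : ℝ} (hx : 0 ≤ x)
    (h : ∀ y, |y| ≤ x → f y ≤ r) : |f| x ≤ r := by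
  change (dualPos (f - -f) + -f) x ≤ r
  rw [add_apply, dualPos_apply _ hx]
  have : posSup (f - -f) x ≤ r + f x := by
    refine posSup_le _ hx fun y h0 hy => ?_
    have h1 : f (y - (x - y)) ≤ r := by
      refine h _ (abs_le'.2 ⟨?_, ?_⟩)
      · exact (sub_le_self _ (sub_nonneg.2 hy)).trans hy
      · rw [neg_sub]
        exact (sub_le_self _ h0).trans (sub_le_self _ h0)
    simp only [map_sub, sub_apply, neg_apply] at h1 ⊢
    linarith
  simp only [neg_apply]
  linarith

theorem apply_le_dual_abs (f : StrongDual ℝ E) (x : E) : f x ≤ |f| |x| := by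
  have h1 : f x⁺ ≤ |f| x⁺ := (le_abs_self f : f ≤ |f|) _ (posPart_nonneg x)
  have h2 : (-f) x⁻ ≤ |f| x⁻ := (neg_le_abs f : -f ≤ |f|) _ (negPart_nonneg x)
  calc f x = f x⁺ + (-f) x⁻ := by
        conv_lhs => rw [← posPart_sub_negPart x]
        rw [map_sub, neg_apply, sub_eq_add_neg]
    _ ≤ |f| x⁺ + |f| x⁻ := add_le_add h1 h2
    _ = |f| |x| := by rw [← map_add, posPart_add_negPart]

/-- The dual norm is a lattice norm. -/
instance dualHasSolidNorm : HasSolidNorm (StrongDual ℝ E) where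
  solid f g h := by
    have key : ∀ x : E, f x ≤ ‖g‖ * ‖x‖ := fun x => by
      refine (apply_le_dual_abs f x).trans ((h |x| (abs_nonneg x)).trans ?_)
      refine dual_abs_apply_le (abs_nonneg x) fun y hy => ?_
      calc g y ≤ ‖g y‖ := le_abs_self _
        _ ≤ ‖g‖ * ‖y‖ := g.le_opNorm y
        _ ≤ ‖g‖ * ‖x‖ := by gcongr; exact norm_le_norm_of_abs_le_abs hy
    refine f.opNorm_le_bound (norm_nonneg g) fun x => abs_le.2 ⟨?_, key x⟩
    have := key (-x)
    rw [map_neg, norm_neg] at this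
    linarith

end Dual

/-! ### Sequences, sets and operators -/

section Notions

/-- A sequence is weakly null: it converges to `0` in the weak topology. -/
def WeaklyNull {X : Type*} [NormedAddCommGroup X] [NormedSpace ℝ X] (x : ℕ → X) : Prop :=
  Tendsto (fun n => toWeakSpace ℝ X (x n)) atTop (𝓝 0)

/-- A sequence in a vector lattice is disjoint: `|x m| ⊓ |x n| = 0` whenever `m ≠ n`. -/
def DisjointSeq {E : Type*} [AddCommGroup E] [Lattice E] (x : ℕ → E) : Prop :=
  ∀ m n, m ≠ n → |x m| ⊓ |x n| = 0

/-- A norm bounded set in whose solid hull every disjoint sequence is weakly null. -/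
def DisjointlyWeaklyCompact {E : Type*} [NormedAddCommGroup E] [NormedSpace ℝ E] [Lattice E]
    (A : Set E) : Prop :=
  Bornology.IsBounded A ∧
    ∀ x : ℕ → E, (∀ n, x n ∈ LatticeOrderedAddCommGroup.solidClosure A) →
      DisjointSeq x → WeaklyNull x

/-- A bounded operator between Banach spaces is weakly compact: the image of the closed unit ball
is relatively compact for the weak topology. -/
def WeaklyCompactOperator {X Y : Type*} [NormedAddCommGroup X] [NormedSpace ℝ X]
    [NormedAddCommGroup Y] [NormedSpace ℝ Y] (T : X →L[ℝ] Y) : Prop :=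
  IsCompact (closure (toWeakSpace ℝ Y '' (T '' Metric.closedBall 0 1)))

/-- A bounded operator on a Banach lattice is almost Dunford–Pettis: it maps disjoint weakly null
sequences to norm null sequences. -/
def AlmostDunfordPettisOperator {E Y : Type*} [NormedAddCommGroup E] [NormedSpace ℝ E] [Lattice E]
    [NormedAddCommGroup Y] [NormedSpace ℝ Y] (T : E →L[ℝ] Y) : Prop :=
  ∀ x : ℕ → E, DisjointSeq x → WeaklyNull x → Tendsto (fun n => T (x n)) atTop (𝓝 0)

/-- The weak Dunford–Pettis property: every weakly compact operator from `E` into an arbitrary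
Banach space (in an arbitrary universe `v`) is almost Dunford–Pettis. -/
def WeakDunfordPettisProperty (E : Type u) [NormedAddCommGroup E] [NormedSpace ℝ E]
    [Lattice E] : Prop :=
  ∀ (Y : Type v) [NormedAddCommGroup Y] [NormedSpace ℝ Y] [CompleteSpace Y] (T : E →L[ℝ] Y),
    WeaklyCompactOperator T → AlmostDunfordPettisOperator T

variable {E : Type*} [NormedAddCommGroup E] [NormedSpace ℝ E] [Lattice E] [IsOrderedAddMonoid E]
  [HasSolidNorm E]

/-- A bounded set `A` in a Banach lattice on which every disjoint weakly null sequence of the dual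
converges uniformly to zero. -/
def AlmostDunfordPettisSet (A : Set E) : Prop :=
  Bornology.IsBounded A ∧
    ∀ f : ℕ → StrongDual ℝ E, DisjointSeq f → WeaklyNull f →
      TendstoUniformlyOn (fun n x => f n x) (fun _ => 0) atTop A

/-- A bounded set `B` in the dual of a Banach lattice on which every disjoint weakly null sequence
of the lattice converges uniformly to zero. -/
def AlmostLSet (B : Set (StrongDual ℝ E)) : Prop :=
  Bornology.IsBounded B ∧
    ∀ x : ℕ → E, DisjointSeq x → WeaklyNull x →
      TendstoUniformlyOn (fun n (f : StrongDual ℝ E) => f (x n)) (fun _ => 0) atTop B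

end Notions

end BanachLattice

set_option linter.unusedSectionVars false

/-! Failure of uniform convergence gives pairings that stay away from zero; on whichever side lacks
disjointness, the entries can be replaced by disjoint ones from the same solid hull, where the
hypothesis applies.

1 → 2: a weakly null sequence of functionals f_n gives the operator x ↦ (f_n x) into c₀, weakly
compact because its extension to the bidual is weak*-to-weak continuous. So property 1 yields f_n
x_n → 0 for weakly null f_n and disjoint weakly null x_n. If |f_n a_n| ≥ ε with a_n in A, then
`exists_disjoint_minorants` replaces |a_n|, along a subsequence, by disjoint u_n ≤ |a_n| at
vanishing cost under |f_n|.

2 → 3: dually, cut |f_n| down to its component on the band of |x_n|. The components are disjoint,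
lie in the solid hull of B and keep their value at |x_n|, while the set of all |x_n| is itself
disjointly weakly compact.

3 → 1: ‖T x_n‖ is a supremum over T'(unit ball), so it suffices that this set is disjointly weakly
compact. For disjoint f_n with |f_n| ≤ |T' g_n| and Φ ≥ 0 in the bidual, the components of Φ on the
bands of the |f_n| yield h_n, absolutely summable at each point, with Φ|f_n| ≤ h_n(T' g_n). Since
T'' maps into Y, a diagonal subsequence and a Baire argument on subsets of ℕ force h_n(T' g_n) → 0.
-/

namespace BanachLattice

/-! ### Disjointness in lattice-ordered groups -/

section Lattice

variable {E : Type*} [AddCommGroup E] [Lattice E] [IsOrderedAddMonoid E]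

theorem inf_add_le_inf_add_inf {a b c : E} (ha : 0 ≤ a) (hb : 0 ≤ b) (hc : 0 ≤ c) :
    a ⊓ (b + c) ≤ a ⊓ b + a ⊓ c := by
  have h1 : a ⊓ (b + c) ≤ a + a ⊓ c := inf_le_left.trans (le_add_of_nonneg_right (le_inf ha hc))
  have h2 : a ⊓ (b + c) ≤ b + a ⊓ c := by
    rw [← sub_le_iff_le_add']
    refine le_inf ((sub_le_self _ hb).trans inf_le_left) ?_
    rw [sub_le_iff_le_add']
    exact inf_le_right
  rw [← sub_le_iff_le_add] at h1 h2 ⊢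
  exact le_inf h1 h2

theorem inf_nsmul_eq_zero {a b : E} (ha : 0 ≤ a) (hb : 0 ≤ b) (h : a ⊓ b = 0) (k : ℕ) :
    a ⊓ k • b = 0 := by
  induction k with
  | zero => simpa using ha
  | succ k ih =>
    refine le_antisymm ?_ (le_inf ha (nsmul_nonneg hb _))
    rw [succ_nsmul]
    refine (inf_add_le_inf_add_inf ha (nsmul_nonneg hb _) hb).trans ?_
    rw [ih, h, add_zero]

theorem inf_sum_eq_zero {ι : Type*} {a : E} {x : ι → E} (ha : 0 ≤ a) (hx : ∀ i, 0 ≤ x i)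
    (S : Finset ι) (h : ∀ i ∈ S, a ⊓ x i = 0) : a ⊓ ∑ i ∈ S, x i = 0 := by
  classical
  induction S using Finset.induction_on with
  | empty => simpa using ha
  | insert i S hi ih =>
    rw [Finset.sum_insert hi]
    refine le_antisymm ?_ (le_inf ha (add_nonneg (hx _) (Finset.sum_nonneg fun j _ => hx j)))
    refine (inf_add_le_inf_add_inf ha (hx _) (Finset.sum_nonneg fun j _ => hx j)).trans ?_
    rw [h i (Finset.mem_insert_self _ _), ih fun j hj => h j (Finset.mem_insert_of_mem hj),
      add_zero]

theorem inf_eq_zero_mono {a b c d : E} (ha : 0 ≤ a) (hb : 0 ≤ b) (hac : a ≤ c) (hbd : b ≤ d)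
    (h : c ⊓ d = 0) : a ⊓ b = 0 :=
  le_antisymm ((inf_le_inf hac hbd).trans h.le) (le_inf ha hb)

/-- Disjoint positive elements below `y` have their sum below `y`. -/
theorem sum_le_of_disjoint {ι : Type*} {x : ι → E} {y : E} (hx : ∀ i, 0 ≤ x i)
    (h : Pairwise fun i j => x i ⊓ x j = 0) (hy : 0 ≤ y) (hxy : ∀ i, x i ≤ y) (S : Finset ι) :
    ∑ i ∈ S, x i ≤ y := by
  classical
  induction S using Finset.induction_on with
  | empty => simpa using hy
  | insert i S hi ih =>
    rw [Finset.sum_insert hi]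
    have h0 : x i ⊓ ∑ j ∈ S, x j = 0 :=
      inf_sum_eq_zero (hx i) hx S fun j hj => h (by rintro rfl; exact hi hj)
    rw [← inf_add_sup, h0, zero_add]
    exact sup_le (hxy i) ih

/-- Meeting |a| ≤ |a + b| + |b| with |a| removes the disjoint summand, so |a + b| dominates |a| and
|b|, hence their join, which is their sum. -/
theorem abs_add_of_inf_eq_zero {a b : E} (h : |a| ⊓ |b| = 0) : |a + b| = |a| + |b| := by
  refine le_antisymm (abs_add_le a b) ?_
  rw [← inf_add_sup, h, zero_add]
  have key : ∀ a b : E, |a| ⊓ |b| = 0 → |a| ≤ |a + b| := by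
    intro a b h
    have h2 : |a| ≤ |a + b| + |b| := by
      calc |a| = |(a + b) - b| := by rw [add_sub_cancel_right]
        _ ≤ |a + b| + |b| := by
          rw [sub_eq_add_neg]; exact (abs_add_le _ _).trans (by rw [abs_neg])
    calc |a| = |a| ⊓ (|a + b| + |b|) := (inf_eq_left.2 h2).symm
      _ ≤ |a| ⊓ |a + b| + |a| ⊓ |b| :=
        inf_add_le_inf_add_inf (abs_nonneg _) (abs_nonneg _) (abs_nonneg _)
      _ ≤ |a + b| := by rw [h, add_zero]; exact inf_le_right
  exact sup_le (key a b h) (by rw [add_comm]; exact key b a (by rw [inf_comm]; exact h))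

theorem abs_sum_of_disjoint {ι : Type*} {x : ι → E}
    (h : Pairwise fun i j => |x i| ⊓ |x j| = 0) (S : Finset ι) :
    |∑ i ∈ S, x i| = ∑ i ∈ S, |x i| := by
  classical
  induction S using Finset.induction_on with
  | empty => simp
  | insert i S hi ih =>
    rw [Finset.sum_insert hi, Finset.sum_insert hi, abs_add_of_inf_eq_zero, ih]
    rw [ih]
    exact inf_sum_eq_zero (abs_nonneg _) (fun j => abs_nonneg _) S
      fun j hj => h (by rintro rfl; exact hi hj)

theorem posPart_inf_posPart_neg (a : E) : a⁺ ⊓ (-a)⁺ = 0 := by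
  rw [posPart_neg]; exact posPart_inf_negPart_eq_zero a

end Lattice

/-! ### Disjointness and real scalars -/

section Module

variable {E : Type*} [AddCommGroup E] [Module ℝ E] [Lattice E] [IsOrderedAddMonoid E]
  [IsOrderedModule ℝ E]

theorem abs_real_smul (c : ℝ) (x : E) : |c • x| = |c| • |x| := by
  have key : ∀ (c : ℝ) (x : E), |c • x| ≤ |c| • |x| := by
    intro c x
    rcases le_total 0 c with hc | hc
    · rw [abs_of_nonneg hc, abs_le', ← smul_neg]
      exact ⟨smul_le_smul_of_nonneg_left (le_abs_self x) hc,
        smul_le_smul_of_nonneg_left (neg_le_abs x) hc⟩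
    · rw [abs_of_nonpos hc, abs_le', ← neg_smul, ← neg_smul_neg c x]
      exact ⟨smul_le_smul_of_nonneg_left (neg_le_abs x) (neg_nonneg.2 hc),
        smul_le_smul_of_nonneg_left (le_abs_self x) (neg_nonneg.2 hc)⟩
  refine le_antisymm (key c x) ?_
  rcases eq_or_ne c 0 with rfl | hc
  · simp
  · have h := smul_le_smul_of_nonneg_left (key c⁻¹ (c • x)) (abs_nonneg c)
    rwa [inv_smul_smul₀ hc, smul_smul, ← abs_mul, mul_inv_cancel₀ hc, abs_one, one_smul] at h

theorem inf_smul_eq_zero {a b : E} (ha : 0 ≤ a) (hb : 0 ≤ b) (h : a ⊓ b = 0) {c : ℝ}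
    (hc : 0 ≤ c) : a ⊓ c • b = 0 := by
  obtain ⟨k, hk⟩ := exists_nat_ge c
  refine inf_eq_zero_mono ha (smul_nonneg hc hb) le_rfl ?_ (inf_nsmul_eq_zero ha hb h k)
  rw [← Nat.cast_smul_eq_nsmul ℝ]
  exact smul_le_smul_of_nonneg_right hk hb

theorem abs_smul_inf_abs_smul {a b : E} (h : |a| ⊓ |b| = 0) (c d : ℝ) :
    |c • a| ⊓ |d • b| = 0 := by
  rw [abs_real_smul, abs_real_smul]
  refine inf_smul_eq_zero (smul_nonneg (abs_nonneg c) (abs_nonneg a)) (abs_nonneg _) ?_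
    (abs_nonneg d)
  rw [inf_comm] at h ⊢
  exact inf_smul_eq_zero (abs_nonneg b) (abs_nonneg a) h (abs_nonneg c)

end Module

theorem DisjointSeq.comp {E : Type*} [AddCommGroup E] [Lattice E] {x : ℕ → E}
    (h : DisjointSeq x) {σ : ℕ → ℕ} (hσ : Function.Injective σ) :
    DisjointSeq fun n => x (σ n) :=
  fun _ _ hmn => h _ _ (hσ.ne hmn)

theorem DisjointSeq.abs {E : Type*} [AddCommGroup E] [Lattice E] [IsOrderedAddMonoid E]
    {x : ℕ → E} (h : DisjointSeq x) : DisjointSeq fun n => |x n| := fun m n hmn => by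
  simpa only [abs_abs] using h m n hmn

/-! ### Weakly null sequences and weakly compact operators -/

section Weak

variable {X Y : Type*} [NormedAddCommGroup X] [NormedSpace ℝ X] [NormedAddCommGroup Y]
  [NormedSpace ℝ Y]

theorem weaklyNull_iff {x : ℕ → X} :
    WeaklyNull x ↔ ∀ f : StrongDual ℝ X, Tendsto (fun n => f (x n)) atTop (𝓝 0) := by
  have hinj : Function.Injective (topDualPairing ℝ X).flip := by
    intro a b hab
    by_contra hne
    obtain ⟨f, hf⟩ := SeparatingDual.exists_separating_of_ne (R := ℝ) hne
    exact hf (LinearMap.congr_fun hab f)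
  refine (WeakBilin.tendsto_iff_forall_eval_tendsto _ hinj).trans ?_
  refine forall_congr' fun f => ?_
  change Tendsto (fun n => f (x n)) atTop (𝓝 (f 0)) ↔ _
  rw [map_zero]

theorem WeaklyNull.comp {x : ℕ → X} (h : WeaklyNull x) {σ : ℕ → ℕ} (hσ : Tendsto σ atTop atTop) :
    WeaklyNull fun n => x (σ n) :=
  weaklyNull_iff.2 fun f => (weaklyNull_iff.1 h f).comp hσ

/-- Uniform boundedness, applied to the sequence viewed in the bidual. -/
theorem WeaklyNull.exists_norm_le {x : ℕ → X} (h : WeaklyNull x) : ∃ C, ∀ n, ‖x n‖ ≤ C := by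
  obtain ⟨C, hC⟩ := banach_steinhaus (g := fun n => NormedSpace.inclusionInDoubleDual ℝ X (x n))
    fun f => by
      obtain ⟨C, hC⟩ := (weaklyNull_iff.1 h f).norm.bddAbove_range
      exact ⟨C, fun n => hC ⟨n, rfl⟩⟩
  exact ⟨C, fun n => ((NormedSpace.inclusionInDoubleDualLi ℝ (E := X)).norm_map (x n)).symm.trans_le
    (hC n)⟩

theorem WeaklyCompactOperator.comp {Z : Type*} [NormedAddCommGroup Z] [NormedSpace ℝ Z]
    {T : X →L[ℝ] Y} (hT : WeaklyCompactOperator T) (L : Y →L[ℝ] Z) :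
    WeaklyCompactOperator (L.comp T) := by
  have hK := hT.image (WeakSpace.map L).continuous
  refine IsCompact.closure_of_subset hK ?_
  rintro _ ⟨_, ⟨x, hx, rfl⟩, rfl⟩
  exact ⟨toWeakSpace ℝ Y (T x), subset_closure ⟨_, ⟨x, hx, rfl⟩, rfl⟩, rfl⟩

end Weak

/-! ### Norming disjoint families by Hahn–Banach -/

section HahnBanach

variable {E : Type*} [NormedAddCommGroup E] [NormedSpace ℝ E] [Lattice E] [IsOrderedAddMonoid E]
  [IsOrderedModule ℝ E] [HasSolidNorm E]

theorem dual_apply_mono {f : StrongDual ℝ E} (hf : 0 ≤ f) {x y : E} (h : x ≤ y) : f x ≤ f y := by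
  have := hf (y - x) (sub_nonneg.2 h)
  rw [map_sub] at this
  simpa using this

theorem dual_apply_nonneg {f : StrongDual ℝ E} (hf : 0 ≤ f) {x : E} (h : 0 ≤ x) : 0 ≤ f x := by
  simpa using hf x h

theorem abs_apply_le_dual_abs (f : StrongDual ℝ E) (x : E) : |f x| ≤ |f| |x| := by
  refine abs_le'.2 ⟨apply_le_dual_abs f x, ?_⟩
  rw [← map_neg, ← abs_neg x]
  exact apply_le_dual_abs f (-x)

/-- The seminorm `x ↦ φ |x|` of a positive functional `φ`. -/
def absSeminorm (φ : StrongDual ℝ E) (hφ : 0 ≤ φ) : Seminorm ℝ E :=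
  Seminorm.of (fun x => φ |x|)
    (fun x y => by
      rw [← map_add]
      exact dual_apply_mono hφ (abs_add_le x y))
    (fun c x => by rw [abs_real_smul, map_smul, smul_eq_mul, Real.norm_eq_abs])

/-- A functional dominated by `φ` that attains `φ |x i|` at all members of a disjoint family. -/
theorem exists_dual_eq_abs {ι : Type*} {φ : StrongDual ℝ E} (hφ : 0 ≤ φ) {x : ι → E}
    (hx : Pairwise fun i j => |x i| ⊓ |x j| = 0) :
    ∃ h : StrongDual ℝ E, (∀ y, |h y| ≤ φ |y|) ∧ ∀ i, h (x i) = φ |x i| := by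
  let L : (ι →₀ ℝ) →ₗ[ℝ] E := Finsupp.linearCombination ℝ x
  let P : (ι →₀ ℝ) →ₗ[ℝ] ℝ := Finsupp.linearCombination ℝ fun i => φ |x i|
  have hP : ∀ a, P a ≤ φ |L a| := by
    intro a
    have h1 : |L a| = ∑ i ∈ a.support, |a i| • |x i| := by
      change |Finsupp.linearCombination ℝ x a| = _
      rw [Finsupp.linearCombination_apply, Finsupp.sum,
        abs_sum_of_disjoint fun i j hij => abs_smul_inf_abs_smul (hx hij) _ _]
      exact Finset.sum_congr rfl fun i _ => abs_real_smul _ _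
    rw [h1, map_sum]
    change Finsupp.linearCombination ℝ (fun i => φ |x i|) a ≤ _
    rw [Finsupp.linearCombination_apply, Finsupp.sum]
    refine Finset.sum_le_sum fun i _ => ?_
    rw [map_smul, smul_eq_mul, smul_eq_mul]
    exact mul_le_mul_of_nonneg_right (le_abs_self _) (dual_apply_nonneg hφ (abs_nonneg _))
  -- The bound P ≤ φ|L ·|, used at a and -a, makes P vanish where L does, so P descends to the span
  -- of the family.
  have hker : LinearMap.ker L.rangeRestrict ≤ LinearMap.ker P := by
    intro a ha
    have ha0 : L a = 0 := by simpa using congrArg Subtype.val (LinearMap.mem_ker.1 ha)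
    rw [LinearMap.mem_ker]
    refine le_antisymm (by simpa [ha0] using hP a) ?_
    have := hP (-a)
    rw [map_neg, map_neg, ha0] at this
    simpa using this
  obtain ⟨P', hP'⟩ : ∃ P' : LinearMap.range L →ₗ[ℝ] ℝ, P' ∘ₗ L.rangeRestrict = P := by
    obtain ⟨r, hr⟩ := L.rangeRestrict.exists_rightInverse_of_surjective L.range_rangeRestrict
    refine ⟨P ∘ₗ r, LinearMap.ext fun a => ?_⟩
    have : r (L.rangeRestrict a) - a ∈ LinearMap.ker P := hker <| by
      rw [LinearMap.mem_ker, map_sub, sub_eq_zero]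
      exact LinearMap.congr_fun hr _
    rw [LinearMap.mem_ker, map_sub, sub_eq_zero] at this
    exact this
  have hval : ∀ a, P' (L.rangeRestrict a) = P a := fun a => LinearMap.congr_fun hP' a
  obtain ⟨g, hg, hgp⟩ := Module.Dual.exists_extension_of_le_seminorm_real (LinearMap.range L) P'
    (p := absSeminorm φ hφ) (by
      rintro ⟨_, a, rfl⟩
      exact (hval a).trans_le (hP a))
  refine ⟨LinearMap.mkContinuous g ‖φ‖ fun y => (hgp y).trans ?_, hgp, fun i => ?_⟩
  · calc φ |y| ≤ ‖φ |y|‖ := le_abs_self _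
      _ ≤ ‖φ‖ * ‖|y|‖ := φ.le_opNorm _
      _ = ‖φ‖ * ‖y‖ := by rw [norm_abs_eq_norm]
  · have h1 := hg (L.rangeRestrict (Finsupp.single i 1))
    rw [hval] at h1
    simpa [L, P] using h1

theorem DisjointSeq.pairwise {x : ℕ → E} (h : DisjointSeq x) :
    Pairwise fun i j => |x i| ⊓ |x j| = 0 := fun _ _ hij => h _ _ hij

theorem weaklyNull_of_forall_nonneg {x : ℕ → E}
    (h : ∀ φ : StrongDual ℝ E, 0 ≤ φ → Tendsto (fun n => φ |x n|) atTop (𝓝 0)) :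
    WeaklyNull x :=
  weaklyNull_iff.2 fun f =>
    squeeze_zero_norm (fun n => abs_apply_le_dual_abs f (x n)) (h |f| (abs_nonneg f))

/-- A single functional takes the values φ|x n| at the x n, thanks to disjointness; without it,
moduli need not stay weakly null. -/
theorem WeaklyNull.tendsto_abs {x : ℕ → E} (hd : DisjointSeq x) (h : WeaklyNull x)
    {φ : StrongDual ℝ E} (hφ : 0 ≤ φ) : Tendsto (fun n => φ |x n|) atTop (𝓝 0) := by
  obtain ⟨g, -, hg⟩ := exists_dual_eq_abs hφ hd.pairwise
  simpa only [hg] using weaklyNull_iff.1 h g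

theorem WeaklyNull.abs {x : ℕ → E} (hd : DisjointSeq x) (h : WeaklyNull x) :
    WeaklyNull fun n => |x n| :=
  weaklyNull_of_forall_nonneg fun φ hφ => by
    simpa only [abs_abs] using h.tendsto_abs hd hφ

end HahnBanach

/-! ### Components of functionals on principal bands -/

section Component

variable {E : Type*} [NormedAddCommGroup E] [NormedSpace ℝ E] [Lattice E] [IsOrderedAddMonoid E]
  [IsOrderedModule ℝ E] [HasSolidNorm E]

theorem norm_le_of_nonneg_of_le {x y : E} (hx : 0 ≤ x) (h : x ≤ y) : ‖x‖ ≤ ‖y‖ :=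
  norm_le_norm_of_abs_le_abs (by rwa [abs_of_nonneg hx, abs_of_nonneg (hx.trans h)])

/-- A bounded nonnegative function, additive on the positive cone, extends to a functional. -/
theorem exists_dual_of_additive {q : E → ℝ} {C : ℝ} (hC : 0 ≤ C) (h0 : ∀ x, 0 ≤ x → 0 ≤ q x)
    (hq : ∀ x, 0 ≤ x → q x ≤ C * ‖x‖)
    (hadd : ∀ x y, 0 ≤ x → 0 ≤ y → q (x + y) = q x + q y) :
    ∃ g : StrongDual ℝ E, ∀ x, 0 ≤ x → g x = q x := by
  let A : E →+ ℝ := AddMonoidHom.mk' (fun x => q x⁺ - q x⁻) (by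
    intro x y
    have h : (x + y)⁺ + (x⁻ + y⁻) = (x⁺ + y⁺) + (x + y)⁻ := by
      have h4 : (x + y)⁺ - (x + y)⁻ = (x⁺ - x⁻) + (y⁺ - y⁻) := by
        simp only [posPart_sub_negPart]
      rw [sub_eq_iff_eq_add] at h4
      rw [h4]
      abel
    have h' := congrArg q h
    rw [hadd _ _ (posPart_nonneg _) (add_nonneg (negPart_nonneg _) (negPart_nonneg _)),
      hadd _ _ (negPart_nonneg _) (negPart_nonneg _),
      hadd _ _ (add_nonneg (posPart_nonneg _) (posPart_nonneg _)) (negPart_nonneg _),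
      hadd _ _ (posPart_nonneg _) (posPart_nonneg _)] at h'
    linarith)
  have hA : ∀ x, ‖A x‖ ≤ C * ‖x‖ := by
    intro x
    have hp : ‖x⁺‖ ≤ ‖x‖ := by
      rw [← norm_abs_eq_norm x]
      exact norm_le_of_nonneg_of_le (posPart_nonneg x) (sup_le (le_abs_self x) (abs_nonneg x))
    have hn : ‖x⁻‖ ≤ ‖x‖ := by
      rw [← norm_abs_eq_norm x]
      exact norm_le_of_nonneg_of_le (negPart_nonneg x) (sup_le (neg_le_abs x) (abs_nonneg x))
    have h1 := (hq _ (posPart_nonneg x)).trans (mul_le_mul_of_nonneg_left hp hC)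
    have h2 := (hq _ (negPart_nonneg x)).trans (mul_le_mul_of_nonneg_left hn hC)
    change |q x⁺ - q x⁻| ≤ _
    rw [abs_le]
    constructor <;> linarith [h0 _ (posPart_nonneg x), h0 _ (negPart_nonneg x)]
  refine ⟨A.toRealLinearMap (AddMonoidHomClass.continuous_of_bound A C hA), fun x hx => ?_⟩
  have hq0 : q 0 = 0 := by simpa using hadd 0 0 le_rfl le_rfl
  change q x⁺ - q x⁻ = q x
  rw [posPart_of_nonneg hx, negPart_of_nonneg hx, hq0, sub_zero]

/-- `g` is the component of the positive functional `f` on the band generated by `x`. -/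
structure IsComponent (f : StrongDual ℝ E) (x : E) (g : StrongDual ℝ E) : Prop where
  nonneg : 0 ≤ g
  le : g ≤ f
  tendsto : ∀ y, 0 ≤ y → Tendsto (fun k : ℕ => f (y ⊓ k • x)) atTop (𝓝 (g y))

/-- The increasing limit of f (y ⊓ k • x) is additive in y ≥ 0 and bounded by f y, so it extends to
a functional. -/
theorem exists_isComponent {f : StrongDual ℝ E} (hf : 0 ≤ f) {x : E} (hx : 0 ≤ x) :
    ∃ g, IsComponent f x g := by
  have hmono : ∀ y, Monotone fun k : ℕ => f (y ⊓ k • x) := fun y k l hkl =>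
    dual_apply_mono hf (inf_le_inf_left _ (nsmul_le_nsmul_left hx hkl))
  have hle : ∀ y, ∀ k : ℕ, f (y ⊓ k • x) ≤ f y := fun y k => dual_apply_mono hf inf_le_left
  have hlim : ∀ y, Tendsto (fun k : ℕ => f (y ⊓ k • x)) atTop (𝓝 (⨆ k : ℕ, f (y ⊓ k • x))) :=
    fun y => tendsto_atTop_ciSup (hmono y) ⟨f y, by rintro _ ⟨k, rfl⟩; exact hle y k⟩
  have hnn : ∀ y, 0 ≤ y → ∀ k : ℕ, 0 ≤ f (y ⊓ k • x) := fun y hy k =>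
    dual_apply_nonneg hf (le_inf hy (nsmul_nonneg hx k))
  have h0 : ∀ y, 0 ≤ y → 0 ≤ ⨆ k : ℕ, f (y ⊓ k • x) := fun y hy =>
    ge_of_tendsto' (hlim y) (hnn y hy)
  have h1 : ∀ y, (⨆ k : ℕ, f (y ⊓ k • x)) ≤ f y := fun y => le_of_tendsto' (hlim y) (hle y)
  obtain ⟨g, hg⟩ := exists_dual_of_additive (q := fun y => ⨆ k : ℕ, f (y ⊓ k • x))
    (norm_nonneg f) h0
    (fun y _ => (h1 y).trans ((le_abs_self _).trans (f.le_opNorm y))) (by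
      intro y z hy hz
      refine le_antisymm ?_ ?_
      · refine le_of_tendsto_of_tendsto' (hlim _) ((hlim y).add (hlim z)) fun k => ?_
        rw [← map_add]
        refine dual_apply_mono hf ?_
        have hk : 0 ≤ k • x := nsmul_nonneg hx k
        have := inf_add_le_inf_add_inf hk hy hz
        rwa [inf_comm, inf_comm y, inf_comm z]
      -- Truncations of y and z at k • x add up to at most (y + z) ⊓ 2k • x, hence the doubled
      -- index.
      · have h2 : Tendsto (fun k : ℕ => 2 * k) atTop atTop :=
          tendsto_id.const_mul_atTop' (by norm_num)
        refine le_of_tendsto_of_tendsto' ((hlim y).add (hlim z)) ((hlim (y + z)).comp h2)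
          fun k => ?_
        rw [← map_add]
        refine dual_apply_mono hf (le_inf (add_le_add inf_le_left inf_le_left) ?_)
        change _ ≤ (2 * k) • x
        rw [two_mul, add_nsmul]
        exact add_le_add inf_le_right inf_le_right)
  refine ⟨g, ⟨fun y hy => ?_, fun y hy => ?_, fun y hy => ?_⟩⟩
  · rw [hg y hy]; exact h0 y hy
  · rw [hg y hy]; exact h1 y
  · rw [hg y hy]; exact hlim y

theorem IsComponent.apply_eq {f g : StrongDual ℝ E} {x y : E} (h : IsComponent f x g)
    (hx : 0 ≤ x) (hy : 0 ≤ y) {k : ℕ} (hk : y ≤ k • x) : g y = f y := by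
  refine tendsto_nhds_unique (h.tendsto y hy) (tendsto_const_nhds.congr' ?_)
  filter_upwards [eventually_ge_atTop k] with l hl
  rw [inf_eq_left.2 (hk.trans (nsmul_le_nsmul_left hx hl))]

theorem IsComponent.apply_eq_zero {f g : StrongDual ℝ E} {x y : E} (h : IsComponent f x g)
    (hx : 0 ≤ x) (hy : 0 ≤ y) (hxy : y ⊓ x = 0) : g y = 0 := by
  refine tendsto_nhds_unique (h.tendsto y hy) (tendsto_const_nhds.congr fun k => ?_)
  rw [inf_nsmul_eq_zero hy hx hxy, map_zero]

/-- Split y into y ⊓ k • x₁ and the rest: g₂ vanishes on the former, and g₁ of the latter tends to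
zero. -/
theorem IsComponent.inf_eq_zero {f₁ f₂ g₁ g₂ : StrongDual ℝ E} {x₁ x₂ : E}
    (h₁ : IsComponent f₁ x₁ g₁) (h₂ : IsComponent f₂ x₂ g₂) (hx₁ : 0 ≤ x₁) (hx₂ : 0 ≤ x₂)
    (h : x₁ ⊓ x₂ = 0) : g₁ ⊓ g₂ = 0 := by
  refine le_antisymm (fun y hy => ?_) (le_inf h₁.nonneg h₂.nonneg)
  have hlim : Tendsto (fun k : ℕ => g₁ y - f₁ (y ⊓ k • x₁)) atTop (𝓝 0) := by
    simpa using (h₁.tendsto y hy).const_sub (g₁ y)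
  refine ge_of_tendsto' hlim fun k => ?_
  have hu0 : 0 ≤ y ⊓ k • x₁ := le_inf hy (nsmul_nonneg hx₁ k)
  have h3 : g₂ (y ⊓ k • x₁) = 0 := by
    refine h₂.apply_eq_zero hx₂ hu0 ?_
    refine inf_eq_zero_mono hu0 hx₂ inf_le_right le_rfl ?_
    rw [inf_comm] at h ⊢
    exact inf_nsmul_eq_zero hx₂ hx₁ h k
  have h4 : g₁ (y ⊓ k • x₁) = f₁ (y ⊓ k • x₁) := h₁.apply_eq hx₁ hu0 inf_le_right
  have h5 := (inf_le_left : g₁ ⊓ g₂ ≤ g₁) (y - y ⊓ k • x₁) (sub_nonneg.2 inf_le_left)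
  have h6 := (inf_le_right : g₁ ⊓ g₂ ≤ g₂) (y ⊓ k • x₁) hu0
  rw [map_sub, map_sub] at h5
  linarith

/-- For each k the truncations y ⊓ k • x i are disjoint and below y, so their sum is too. -/
theorem sum_component_le {ι : Type*} {f : StrongDual ℝ E} (hf : 0 ≤ f) {x : ι → E}
    (hx : ∀ i, 0 ≤ x i) (hd : Pairwise fun i j => x i ⊓ x j = 0) {g : ι → StrongDual ℝ E}
    (hg : ∀ i, IsComponent f (x i) (g i)) {y : E} (hy : 0 ≤ y) (S : Finset ι) :
    ∑ i ∈ S, g i y ≤ f y := by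
  refine le_of_tendsto' (tendsto_finsetSum S fun i _ => (hg i).tendsto y hy) fun k => ?_
  rw [← map_sum]
  refine dual_apply_mono hf (sum_le_of_disjoint (fun i => le_inf hy (nsmul_nonneg (hx i) k)) ?_ hy
    (fun i => inf_le_left) S)
  intro i j hij
  refine inf_eq_zero_mono (le_inf hy (nsmul_nonneg (hx i) k)) (le_inf hy (nsmul_nonneg (hx j) k))
    inf_le_right inf_le_right ?_
  refine inf_nsmul_eq_zero (nsmul_nonneg (hx i) k) (hx j) ?_ k
  rw [inf_comm]
  exact inf_nsmul_eq_zero (hx j) (hx i) (by rw [inf_comm]; exact hd hij) k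

theorem tendsto_of_disjoint_of_le {f : StrongDual ℝ E} (hf : 0 ≤ f) {x : ℕ → E} {y : E}
    (hx : ∀ n, 0 ≤ x n) (hd : Pairwise fun i j => x i ⊓ x j = 0) (hy : 0 ≤ y)
    (hxy : ∀ n, x n ≤ y) : Tendsto (fun n => f (x n)) atTop (𝓝 0) := by
  have : Summable fun n => f (x n) :=
    summable_of_sum_le (fun n => dual_apply_nonneg hf (hx n)) (c := f y) fun S => by
      rw [← map_sum]
      exact dual_apply_mono hf (sum_le_of_disjoint hx hd hy hxy S)
  exact this.tendsto_atTop_zero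

theorem disjointlyWeaklyCompact_range {x : ℕ → E} (hd : DisjointSeq x) (hw : WeaklyNull x) :
    DisjointlyWeaklyCompact (Set.range x) := by
  refine ⟨?_, fun y hy hyd => weaklyNull_of_forall_nonneg fun φ hφ => ?_⟩
  · obtain ⟨C, hC⟩ := hw.exists_norm_le
    exact isBounded_iff_forall_norm_le.2 ⟨C, by rintro _ ⟨n, rfl⟩; exact hC n⟩
  · have hy' : ∀ k, ∃ n, |y k| ≤ |x n| := fun k => by
      obtain ⟨_, ⟨n, rfl⟩, h⟩ := hy k
      exact ⟨n, h⟩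
    choose n hn using hy'
    have hφx := hw.tendsto_abs hd hφ
    rw [Metric.tendsto_atTop] at hφx
    rw [Metric.tendsto_atTop]
    intro ε hε
    obtain ⟨N, hN⟩ := hφx ε hε
    -- Terms y k dominated by a late x n are small under φ; the others lie below w, where disjoint
    -- order bounded sequences tend to zero under φ.
    set w : E := ∑ i ∈ Finset.range N, |x i|
    have hw0 : 0 ≤ w := Finset.sum_nonneg fun i _ => abs_nonneg _
    have hz := tendsto_of_disjoint_of_le hφ (x := fun k => |y k| ⊓ w)
      (fun k => le_inf (abs_nonneg _) hw0)
      (fun i j hij => inf_eq_zero_mono (le_inf (abs_nonneg _) hw0) (le_inf (abs_nonneg _) hw0)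
        inf_le_left inf_le_left (hyd i j hij)) hw0 (fun k => inf_le_right)
    rw [Metric.tendsto_atTop] at hz
    obtain ⟨M, hM⟩ := hz ε hε
    refine ⟨M, fun k hk => ?_⟩
    rw [Real.dist_0_eq_abs, abs_of_nonneg (dual_apply_nonneg hφ (abs_nonneg _))]
    by_cases hnk : N ≤ n k
    · exact (dual_apply_mono hφ (hn k)).trans_lt
        ((le_abs_self _).trans_lt (by simpa [Real.dist_eq] using hN _ hnk))
    · have hle : |y k| ≤ w := (hn k).trans
        (Finset.single_le_sum (f := fun i => |x i|) (fun i _ => abs_nonneg _)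
          (Finset.mem_range.2 (not_le.1 hnk)))
      have := hM k hk
      rw [inf_eq_left.2 hle, Real.dist_0_eq_abs] at this
      exact (le_abs_self _).trans_lt this

end Component

/-! ### Extracting disjoint minorants -/

section Disjointification

variable {E : Type*} [NormedAddCommGroup E] [NormedSpace ℝ E] [CompleteSpace E] [Lattice E]
  [IsOrderedAddMonoid E] [IsOrderedModule ℝ E] [HasSolidNorm E]

/-- A strictly increasing sequence in which each term is large relative to the previous one. -/
theorem exists_strictMono_of_eventually {p : ℕ → ℕ → Prop} (h : ∀ N, ∀ᶠ n in atTop, p N n) :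
    ∃ σ : ℕ → ℕ, StrictMono σ ∧ ∀ k, p (σ k) (σ (k + 1)) := by
  choose next hnext using fun N => ((h N).and (eventually_gt_atTop N)).exists
  let σ : ℕ → ℕ := fun k => Nat.rec 0 (fun _ m => next m) k
  exact ⟨σ, strictMono_nat_of_lt_succ fun k => (hnext (σ k)).2, fun k => (hnext (σ k)).1⟩

theorem exists_disjoint_minorants {x : ℕ → E} (hx : ∀ n, 0 ≤ x n) (hb : ∃ C, ∀ n, ‖x n‖ ≤ C)
    {f : ℕ → StrongDual ℝ E} (hf : ∀ n, 0 ≤ f n)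
    (hlim : ∀ y, Tendsto (fun n => f n y) atTop (𝓝 0)) :
    ∃ (σ : ℕ → ℕ) (u : ℕ → E), StrictMono σ ∧ DisjointSeq u ∧
      (∀ k, 0 ≤ u k ∧ u k ≤ x (σ k)) ∧
      Tendsto (fun k => f (σ k) (x (σ k)) - f (σ k) (u k)) atTop (𝓝 0) := by
  obtain ⟨C, hC⟩ := hb
  -- Only consecutive indices are compared, so the sum runs over all i ≤ N; since k ≤ σ k it
  -- dominates 4^(k+1) times the sum of the terms selected up to k.
  obtain ⟨σ, hσ, hσf⟩ := exists_strictMono_of_eventually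
    (p := fun N n => f n ((4 : ℝ) ^ (N + 1) • ∑ i ∈ Finset.range (N + 1), x i) < (1 / 2 : ℝ) ^ N)
    fun N => (hlim _).eventually_lt_const (by positivity)
  have hsum : Summable fun i => (1 / 2 : ℝ) ^ i • x (σ i) := by
    refine Summable.of_norm_bounded (g := fun i => (1 / 2 : ℝ) ^ i * C)
      (summable_geometric_two.mul_right C) fun i => ?_
    rw [norm_smul, norm_pow, Real.norm_of_nonneg (by norm_num : (0 : ℝ) ≤ 1 / 2)]
    exact mul_le_mul_of_nonneg_left (hC _) (by positivity)
  set w : E := ∑' i, (1 / 2 : ℝ) ^ i • x (σ i)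
  have hterm : ∀ i, 0 ≤ (1 / 2 : ℝ) ^ i • x (σ i) := fun i => smul_nonneg (by positivity) (hx _)
  have hw : ∀ i, (1 / 2 : ℝ) ^ i • x (σ i) ≤ w := fun i => hsum.le_tsum i fun j _ => hterm j
  have hw0 : 0 ≤ w := (hterm 0).trans (hw 0)
  let s : ℕ → E := fun k => (4 : ℝ) ^ k • ∑ i ∈ Finset.range k, x (σ i)
  have hs0 : ∀ k, 0 ≤ s k := fun k =>
    smul_nonneg (by positivity) (Finset.sum_nonneg fun i _ => hx _)
  -- For m < n, subtracting s n puts u n below a⁺ with a = x (σ n) - 4^n • x (σ m); subtracting the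
  -- multiple of w puts u m below a multiple of (-a)⁺, which is disjoint from a⁺.
  let u : ℕ → E := fun k => (x (σ k) - s k - (1 / 2 : ℝ) ^ k • w)⁺
  have hux : ∀ k, u k ≤ x (σ k) := fun k => sup_le
    ((sub_le_self _ (smul_nonneg (by positivity) hw0)).trans (sub_le_self _ (hs0 k))) (hx _)
  have hu0 : ∀ k, 0 ≤ u k := fun k => posPart_nonneg _
  refine ⟨σ, u, hσ, ?_, fun k => ⟨hu0 k, hux k⟩, ?_⟩
  · have key : ∀ m n, m < n → u m ⊓ u n = 0 := by
      intro m n hmn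
      set a : E := x (σ n) - (4 : ℝ) ^ n • x (σ m)
      have hn : u n ≤ a⁺ := by
        refine posPart_mono ?_
        refine (sub_le_self _ (smul_nonneg (by positivity) hw0)).trans (sub_le_sub_left ?_ _)
        exact smul_le_smul_of_nonneg_left
          (Finset.single_le_sum (f := fun i => x (σ i)) (fun i _ => hx _)
            (Finset.mem_range.2 hmn)) (by positivity)
      have hm : u m ≤ ((1 / 2 : ℝ) ^ (m + n)) • (-a)⁺ := by
        refine sup_le ?_ (smul_nonneg (by positivity) (posPart_nonneg _))
        have h1 : (1 / 2 : ℝ) ^ (m + n) • (-a) ≤ (1 / 2 : ℝ) ^ (m + n) • (-a)⁺ :=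
          smul_le_smul_of_nonneg_left (le_posPart _) (by positivity)
        refine le_trans ?_ h1
        have h2 : (1 / 2 : ℝ) ^ (m + n) • x (σ n) ≤ (1 / 2 : ℝ) ^ m • w := by
          rw [pow_add, mul_smul]
          exact smul_le_smul_of_nonneg_left (hw n) (by positivity)
        -- The factor equals 2^(n-m), which is at least 1.
        have h3 : x (σ m) ≤ ((1 / 2 : ℝ) ^ (m + n) * 4 ^ n) • x (σ m) := by
          refine le_smul_of_one_le_left (hx _) ?_
          have : (1 / 2 : ℝ) ^ (m + n) * 4 ^ n = (1 / 2) ^ m * 2 ^ n := by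
            rw [pow_add, mul_assoc, ← mul_pow]; norm_num
          rw [this, one_div, inv_pow, ← div_eq_inv_mul, one_le_div (by positivity)]
          exact pow_le_pow_right₀ (by norm_num) hmn.le
        calc x (σ m) - s m - (1 / 2 : ℝ) ^ m • w ≤ x (σ m) - (1 / 2 : ℝ) ^ m • w :=
              sub_le_sub_right (sub_le_self _ (hs0 m)) _
          _ ≤ ((1 / 2 : ℝ) ^ (m + n) * 4 ^ n) • x (σ m) - (1 / 2 : ℝ) ^ (m + n) • x (σ n) :=
              sub_le_sub h3 h2
          _ = (1 / 2 : ℝ) ^ (m + n) • (-a) := by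
              rw [neg_sub, smul_sub, smul_smul]
      refine inf_eq_zero_mono (hu0 m) (hu0 n) hm hn ?_
      rw [inf_comm]
      exact inf_smul_eq_zero (posPart_nonneg _) (posPart_nonneg _) (posPart_inf_posPart_neg a)
        (by positivity)
    intro m n hmn
    rw [abs_of_nonneg (hu0 m), abs_of_nonneg (hu0 n)]
    rcases lt_or_gt_of_ne hmn with h | h
    · exact key m n h
    · rw [inf_comm]; exact key n m h
  · have hlim1 : Tendsto (fun k => (1 / 2 : ℝ) ^ k + f (σ (k + 1)) w) atTop (𝓝 0) := by
      simpa using (tendsto_pow_atTop_nhds_zero_of_lt_one (by norm_num : (0 : ℝ) ≤ 1 / 2)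
        (by norm_num)).add ((hlim w).comp (hσ.tendsto_atTop.comp (tendsto_add_atTop_nat 1)))
    -- The selection controls f (σ (k + 1)) on earlier terms and says nothing about k = 0.
    rw [← tendsto_add_atTop_iff_nat 1]
    refine squeeze_zero (fun k => sub_nonneg.2 (dual_apply_mono (hf _) (hux _))) (fun k => ?_)
      hlim1
    have h1 : f (σ (k + 1)) (x (σ (k + 1)) - s (k + 1) - (1 / 2 : ℝ) ^ (k + 1) • w)
        ≤ f (σ (k + 1)) (u (k + 1)) := dual_apply_mono (hf _) (le_posPart _)
    have h2 : f (σ (k + 1)) (s (k + 1)) ≤ (1 / 2 : ℝ) ^ k := by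
      have h3 : s (k + 1) ≤ (4 : ℝ) ^ (σ k + 1) • ∑ i ∈ Finset.range (σ k + 1), x i := by
        refine _root_.smul_le_smul (pow_le_pow_right₀ (by norm_num)
          (Nat.succ_le_succ (hσ.id_le k))) ?_ (by positivity)
          (Finset.sum_nonneg fun i _ => hx _)
        rw [← Finset.sum_image (f := x) (g := σ) fun i _ j _ h => hσ.injective h]
        refine Finset.sum_le_sum_of_subset_of_nonneg ?_ fun i _ _ => hx i
        intro i hi
        obtain ⟨j, hj, rfl⟩ := Finset.mem_image.1 hi
        exact Finset.mem_range.2 (Nat.lt_succ_of_le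
          (hσ.monotone (Nat.le_of_lt_succ (Finset.mem_range.1 hj))))
      refine (dual_apply_mono (hf _) h3).trans ((hσf k).le.trans ?_)
      exact pow_le_pow_of_le_one (by norm_num) (by norm_num) (hσ.id_le k)
    have h4 : f (σ (k + 1)) ((1 / 2 : ℝ) ^ (k + 1) • w) ≤ f (σ (k + 1)) w := by
      rw [map_smul, smul_eq_mul]
      exact mul_le_of_le_one_left (dual_apply_nonneg (hf _) hw0)
        (pow_le_one₀ (by norm_num) (by norm_num))
    rw [map_sub, map_sub] at h1
    linarith

end Disjointification

/-! ### Weakly null functionals as operators into c₀ -/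

section NullSequences

open ZeroAtInfty

/-- A null sequence as an element of `C₀(ℕ, ℝ)`. -/
def ofNullSeq (a : ℕ → ℝ) (h : Tendsto a atTop (𝓝 0)) : C₀(ℕ, ℝ) where
  toFun := a
  continuous_toFun := continuous_of_discreteTopology
  zero_at_infty' := by rwa [Filter.cocompact_eq_cofinite, Nat.cofinite_eq_atTop]

theorem c0_tendsto (v : C₀(ℕ, ℝ)) : Tendsto v atTop (𝓝 0) := by
  have := v.zero_at_infty'
  rwa [Filter.cocompact_eq_cofinite, Nat.cofinite_eq_atTop] at this

theorem c0_norm_le {v : C₀(ℕ, ℝ)} {C : ℝ} (hC : 0 ≤ C) (h : ∀ n, |v n| ≤ C) : ‖v‖ ≤ C := by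
  rw [← ZeroAtInftyContinuousMap.norm_toBCF_eq_norm]
  exact (BoundedContinuousFunction.norm_le hC).2 h

theorem c0_abs_apply_le (v : C₀(ℕ, ℝ)) (n : ℕ) : |v n| ≤ ‖v‖ := by
  rw [← ZeroAtInftyContinuousMap.norm_toBCF_eq_norm]
  exact v.toBCF.norm_coe_le_norm n

/-- The unit vectors of `C₀(ℕ, ℝ)`. -/
def c0Unit (n : ℕ) : C₀(ℕ, ℝ) :=
  ofNullSeq (fun m => if m = n then 1 else 0) (tendsto_const_nhds.congr' (by
    filter_upwards [eventually_gt_atTop n] with m hm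
    rw [if_neg hm.ne']))

theorem c0_sum_apply (a : ℕ → ℝ) (S : Finset ℕ) (m : ℕ) :
    (∑ n ∈ S, a n • c0Unit n) m = if m ∈ S then a m else 0 := by
  have h : ∀ S : Finset ℕ, (∑ n ∈ S, a n • c0Unit n) m = ∑ n ∈ S, (a n • c0Unit n) m := by
    intro S
    classical
    induction S using Finset.induction_on with
    | empty => simp
    | insert i S hi ih =>
      rw [Finset.sum_insert hi, Finset.sum_insert hi, ZeroAtInftyContinuousMap.add_apply, ih]
  rw [h]
  have h2 : ∀ n, (a n • c0Unit n) m = if m = n then a n else 0 := fun n => by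
    rw [ZeroAtInftyContinuousMap.smul_apply]
    change a n • (if m = n then (1 : ℝ) else 0) = _
    split_ifs <;> simp
  simp_rw [h2]
  exact Finset.sum_ite_eq S m a

/-- Signed sums of unit vectors have norm at most 1, so ‖φ‖ bounds all partial sums. -/
theorem c0_summable_dual (φ : StrongDual ℝ C₀(ℕ, ℝ)) : Summable fun n => |φ (c0Unit n)| := by
  refine summable_of_sum_le (fun n => abs_nonneg _) (c := ‖φ‖) fun S => ?_
  have h1 : ∑ n ∈ S, |φ (c0Unit n)|
      = φ (∑ n ∈ S, (SignType.sign (φ (c0Unit n)) : ℝ) • c0Unit n) := by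
    rw [map_sum]
    refine Finset.sum_congr rfl fun n _ => ?_
    rw [map_smul, smul_eq_mul, sign_mul_self]
  rw [h1]
  refine (le_abs_self _).trans ((φ.le_opNorm _).trans
    (mul_le_of_le_one_right (norm_nonneg _) (c0_norm_le zero_le_one fun m => ?_)))
  rw [c0_sum_apply]
  split_ifs
  · rcases (SignType.sign (φ (c0Unit m))) with _ | _ | _ <;> simp
  · simp

theorem c0_tendsto_sum (v : C₀(ℕ, ℝ)) :
    Tendsto (fun N => ∑ n ∈ Finset.range N, v n • c0Unit n) atTop (𝓝 v) := by
  rw [Metric.tendsto_atTop]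
  intro ε hε
  obtain ⟨N, hN⟩ := Metric.tendsto_atTop.1 (c0_tendsto v) (ε / 2) (half_pos hε)
  refine ⟨N, fun M hM => ?_⟩
  rw [dist_eq_norm]
  refine (c0_norm_le (half_pos hε).le fun m => ?_).trans_lt (half_lt_self hε)
  rw [ZeroAtInftyContinuousMap.sub_apply, c0_sum_apply]
  split_ifs with h
  · simpa using (half_pos hε).le
  · rw [zero_sub, abs_neg]
    simpa [Real.dist_eq] using
      (hN m (hM.trans (not_lt.1 fun h' => h (Finset.mem_range.2 h')))).le

variable {X : Type*} [NormedAddCommGroup X] [NormedSpace ℝ X]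

/-- A weakly null sequence of functionals defines a weakly compact operator into `C₀(ℕ, ℝ)`. -/
theorem exists_weaklyCompactOperator_c0 {f : ℕ → StrongDual ℝ X} (hf : WeaklyNull f) :
    ∃ T : X →L[ℝ] C₀(ℕ, ℝ), WeaklyCompactOperator T ∧ ∀ x n, T x n = f n x := by
  obtain ⟨C, hC⟩ := hf.exists_norm_le
  have hC0 : 0 ≤ C := (norm_nonneg _).trans (hC 0)
  have hlim := weaklyNull_iff.1 hf
  let S : StrongDual ℝ (StrongDual ℝ X) →ₗ[ℝ] C₀(ℕ, ℝ) :=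
    { toFun := fun H => ofNullSeq (fun n => H (f n)) (hlim H)
      map_add' := fun H G => rfl
      map_smul' := fun c H => rfl }
  have hS : ∀ H n, S H n = H (f n) := fun _ _ => rfl
  have hSnorm : ∀ H, ‖S H‖ ≤ C * ‖H‖ := fun H =>
    c0_norm_le (by positivity) fun n => by
      rw [hS, mul_comm]
      exact (H.le_opNorm _).trans (mul_le_mul_of_nonneg_left (hC n) (norm_nonneg _))
  -- As φ is an ℓ¹ sequence, φ ∘ S is evaluation at F = ∑ φ(e_n) f_n. This makes S weak*-to-weak
  -- continuous, and Banach–Alaoglu then gives compactness.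
  have heval : ∀ φ : StrongDual ℝ C₀(ℕ, ℝ), ∃ F : StrongDual ℝ X, ∀ H, φ (S H) = H F := by
    intro φ
    have hs : Summable fun n => φ (c0Unit n) • f n := by
      refine Summable.of_norm_bounded (g := fun n => |φ (c0Unit n)| * C)
        ((c0_summable_dual φ).mul_right C) fun n => ?_
      rw [norm_smul]
      exact mul_le_mul_of_nonneg_left (hC n) (norm_nonneg _)
    refine ⟨∑' n, φ (c0Unit n) • f n, fun H => ?_⟩
    have h1 := (φ.continuous.tendsto _).comp (c0_tendsto_sum (S H))
    have h2 := (H.continuous.tendsto _).comp hs.hasSum.tendsto_sum_nat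
    refine tendsto_nhds_unique h1 (h2.congr fun N => ?_)
    simp only [Function.comp_apply, map_sum, map_smul, smul_eq_mul, hS]
    exact Finset.sum_congr rfl fun n _ => mul_comm _ _
  let S' : StrongDual ℝ (StrongDual ℝ X) →L[ℝ] C₀(ℕ, ℝ) :=
    ⟨S, AddMonoidHomClass.continuous_of_bound S C hSnorm⟩
  refine ⟨S'.comp (NormedSpace.inclusionInDoubleDual ℝ X), ?_, fun x n => rfl⟩
  have hcont : Continuous fun H : WeakDual ℝ (StrongDual ℝ X) =>
      toWeakSpace ℝ C₀(ℕ, ℝ) (S (WeakDual.toStrongDual H)) := by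
    refine WeakBilin.continuous_of_continuous_eval _ fun φ => ?_
    obtain ⟨F, hF⟩ := heval φ
    refine (WeakDual.eval_continuous F).congr fun H => ?_
    exact (hF (WeakDual.toStrongDual H)).symm
  have hK := (WeakDual.isCompact_closedBall (𝕜 := ℝ) (0 : StrongDual ℝ (StrongDual ℝ X)) 1).image
    hcont
  refine hK.closure_of_subset ?_
  rintro _ ⟨_, ⟨x, hx, rfl⟩, rfl⟩
  refine ⟨StrongDual.toWeakDual (NormedSpace.inclusionInDoubleDual ℝ X x), ?_, rfl⟩
  rw [mem_closedBall_zero_iff] at hx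
  exact (mem_closedBall_zero_iff (E := StrongDual ℝ (StrongDual ℝ X))).2
    ((NormedSpace.double_dual_bound ℝ X x).trans hx)

end NullSequences

/-! ### Diagonal pairings under the weak Dunford–Pettis property -/

section Universe

open ZeroAtInfty

variable {E : Type u} [NormedAddCommGroup E] [NormedSpace ℝ E] [Lattice E]

theorem WeakDunfordPettisProperty.tendsto_apply (h : WeakDunfordPettisProperty.{u, v} E)
    {f : ℕ → StrongDual ℝ E} (hf : WeaklyNull f) {x : ℕ → E} (hd : DisjointSeq x)
    (hx : WeaklyNull x) : Tendsto (fun n => f n (x n)) atTop (𝓝 0) := by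
  obtain ⟨T, hT, hTf⟩ := exists_weaklyCompactOperator_c0 hf
  -- The property quantifies over spaces in universe v, so c₀ is lifted there.
  let L : C₀(ℕ, ℝ) ≃L[ℝ] ULift.{v} C₀(ℕ, ℝ) := ContinuousLinearEquiv.ulift.symm
  have h1 := h (ULift.{v} C₀(ℕ, ℝ)) ((L : C₀(ℕ, ℝ) →L[ℝ] ULift.{v} C₀(ℕ, ℝ)).comp T)
    (hT.comp _) x hd hx
  have h2 : Tendsto (fun n => T (x n)) atTop (𝓝 0) := by
    have := (L.symm.continuous.tendsto 0).comp h1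
    simpa [Function.comp_def] using this
  refine squeeze_zero_norm (fun n => ?_) (tendsto_zero_iff_norm_tendsto_zero.1 h2)
  rw [← hTf, Real.norm_eq_abs]
  exact c0_abs_apply_le _ n

end Universe

/-! ### A Nikodym-type lemma on the Cantor space -/

section Baire

/-- Nikodym-type convergence: if the subset sums of summable sequences `a k` converge for every
subset, then the `a k` converge uniformly along their tails. -/
theorem tendsto_diagonal_of_subsetSums {a : ℕ → ℕ → ℝ} (hs : ∀ k, Summable fun m => |a k m|)
    (hc : ∀ s : ℕ → Bool, CauchySeq fun k => ∑' m, if s m then a k m else 0)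
    {σ : ℕ → ℕ} (hσ : Tendsto σ atTop atTop) :
    Tendsto (fun k => a k (σ k)) atTop (𝓝 0) := by
  set μ : ℕ → (ℕ → Bool) → ℝ := fun k s => ∑' m, if s m then a k m else 0
  have hle : ∀ k m (b : Bool), ‖(if b then a k m else 0 : ℝ)‖ ≤ |a k m| := by
    intro k m b
    split_ifs
    · exact le_rfl
    · simp
  have hsum : ∀ k (s : ℕ → Bool), Summable fun m => if s m then a k m else 0 := fun k s =>
    Summable.of_norm_bounded (hs k) fun m => hle k m (s m)
  have hμ : ∀ k, Continuous (μ k) := fun k => by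
    refine continuous_tsum (u := fun m => |a k m|) (fun m => ?_) (hs k) fun m s => hle k m (s m)
    exact (continuous_of_discreteTopology (f := fun b : Bool => if b then a k m else 0)).comp
      (continuous_apply m)
  have hupd : ∀ k m (s : ℕ → Bool),
      μ k (Function.update s m true) - μ k (Function.update s m false) = a k m := by
    intro k m s
    rw [← (hsum k _).tsum_sub (hsum k _), tsum_eq_single m]
    · simp
    · intro i hi
      simp [Function.update_of_ne hi]
  rw [Metric.tendsto_atTop]
  intro ε hε
  have hε4 : 0 < ε / 4 := by positivity
  -- By the Cauchy hypothesis these closed sets cover the Cantor space, so one has interior. A basic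
  -- open set fixes only the coordinates in a finite I; toggling any other coordinate stays inside
  -- and isolates a single a j m.
  let F : ℕ → Set (ℕ → Bool) := fun N => ⋂ j ≥ N, {s | |μ j s - μ N s| ≤ ε / 4}
  have hFc : ∀ N, IsClosed (F N) := fun N => isClosed_biInter fun j _ =>
    isClosed_le (((hμ j).sub (hμ N)).abs) continuous_const
  have hFU : ⋃ N, F N = Set.univ := by
    refine Set.eq_univ_of_forall fun s => ?_
    obtain ⟨N, hN⟩ := Metric.cauchySeq_iff'.1 (hc s) (ε / 4) hε4
    refine Set.mem_iUnion.2 ⟨N, Set.mem_iInter₂.2 fun j hj => ?_⟩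
    exact (hN j hj).le
  obtain ⟨N, s₀, hs₀⟩ := nonempty_interior_of_iUnion_of_closed hFc hFU
  obtain ⟨I, U, hU, hIU⟩ := isOpen_pi_iff.1 isOpen_interior s₀ hs₀
  have hmem : ∀ m ∉ I, ∀ b, Function.update s₀ m b ∈ F N := by
    intro m hm b
    refine interior_subset (hIU fun i hi => ?_)
    rw [Function.update_of_ne (by rintro rfl; exact hm hi)]
    exact (hU i hi).2
  have hdiff : ∀ m ∉ I, ∀ j ≥ N, |a j m - a N m| ≤ ε / 2 := by
    intro m hm j hj
    have hb : ∀ b, |μ j (Function.update s₀ m b) - μ N (Function.update s₀ m b)| ≤ ε / 4 :=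
      fun b => Set.mem_iInter₂.1 (hmem m hm b) j hj
    have h1 := abs_le.1 (hb true)
    have h2 := abs_le.1 (hb false)
    rw [← hupd j m s₀, ← hupd N m s₀, abs_le]
    constructor <;> linarith [h1.1, h1.2, h2.1, h2.2]
  have h1 : ∀ᶠ k in atTop, σ k ∉ I := by
    exact hσ.eventually (by
      rw [← Nat.cofinite_eq_atTop]
      exact I.finite_toSet.eventually_cofinite_notMem)
  have h2 : ∀ᶠ k in atTop, |a N (σ k)| < ε / 2 := by
    have := (hs N).tendsto_atTop_zero.comp hσ
    exact this.eventually_lt_const (half_pos hε)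
  obtain ⟨M, hM⟩ := ((h1.and h2).and (eventually_ge_atTop N)).exists_forall_of_atTop
  refine ⟨M, fun k hk => ?_⟩
  obtain ⟨⟨hkI, hk2⟩, hkN⟩ := hM k hk
  have := abs_le.1 (hdiff _ hkI k hkN)
  have hk2 := abs_lt.1 hk2
  rw [Real.dist_0_eq_abs, abs_lt]
  constructor <;> linarith [this.1, this.2, hk2.1, hk2.2]

end Baire

/-! ### Second adjoints of weakly compact operators -/

section Bidual

variable {X Y : Type*} [NormedAddCommGroup X] [NormedSpace ℝ X] [NormedAddCommGroup Y]
  [NormedSpace ℝ Y]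

theorem exists_weakDual_eq_eval (l : StrongDual ℝ (WeakDual ℝ X)) :
    ∃ x : X, ∀ L : WeakDual ℝ X, l L = L x := by
  obtain ⟨x, hx⟩ := LinearMap.dualEmbedding_surjective (𝕜 := ℝ) (E := StrongDual ℝ X) (F := X)
    (topDualPairing ℝ X) l
  exact ⟨x, fun L => by rw [← hx]; rfl⟩

/-- The second adjoint of a weakly compact operator takes values in `Y`. -/
theorem WeaklyCompactOperator.exists_bidual_eq {T : X →L[ℝ] Y} (hT : WeaklyCompactOperator T)
    (H : StrongDual ℝ (StrongDual ℝ X)) :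
    ∃ y : Y, ∀ g : StrongDual ℝ Y, g y = H (g.comp T) := by
  have key : ∀ H : StrongDual ℝ (StrongDual ℝ X), (∀ f, H f ≤ ‖f‖) →
      ∃ y : Y, ∀ g : StrongDual ℝ Y, g y = H (g.comp T) := by
    intro H hH
    let J := NormedSpace.inclusionInDoubleDualWeak ℝ Y
    set K : Set (WeakSpace ℝ Y) := closure (toWeakSpace ℝ Y '' (T '' Metric.closedBall 0 1))
    have hK : IsCompact K := hT
    have hKconv : Convex ℝ K :=
      (((convex_closedBall (0 : X) 1).linear_image T.toLinearMap).linear_image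
        (toWeakSpace ℝ Y).toLinearMap).closure
    have hclosed : IsClosed (J '' K) := (hK.image J.continuous).isClosed
    have hconv : Convex ℝ (J '' K) := hKconv.linear_image J.toLinearMap
    let G : WeakDual ℝ (StrongDual ℝ Y) := StrongDual.toWeakDual
      (H.comp ((ContinuousLinearMap.compL ℝ X Y ℝ).flip T))
    have hG : ∀ g, G g = H (g.comp T) := fun _ => rfl
    by_cases hmem : G ∈ J '' K
    · obtain ⟨y, -, hy⟩ := hmem
      exact ⟨(toWeakSpace ℝ Y).symm y, fun g => by rw [← hG, ← hy]; rfl⟩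
    -- A weak* continuous separating functional is evaluation at some g. Being below r on T(ball)
    -- gives ‖g.comp T‖ ≤ r, contradicting r < H (g.comp T).
    exfalso
    have : LocallyConvexSpace ℝ (WeakDual ℝ (StrongDual ℝ Y)) :=
      (WeakDual.withSeminorms ℝ (StrongDual ℝ Y)).toLocallyConvexSpace
    obtain ⟨l, r, hl, hr⟩ := geometric_hahn_banach_closed_point hconv hclosed hmem
    obtain ⟨g, hg⟩ := exists_weakDual_eq_eval l
    have hball : ∀ x ∈ Metric.closedBall (0 : X) 1, g (T x) < r := by
      intro x hx
      have := hl (J (toWeakSpace ℝ Y (T x))) ⟨_, subset_closure ⟨_, ⟨x, hx, rfl⟩, rfl⟩, rfl⟩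
      rw [hg] at this
      exact this
    have hr0 : 0 < r := by simpa using hball 0 (by simp)
    have hnorm : ‖g.comp T‖ ≤ r := by
      refine ContinuousLinearMap.opNorm_le_of_unit_norm hr0.le fun x hx => ?_
      have h1 := hball x (by simp [hx])
      have h2 := hball (-x) (by simp [hx])
      rw [map_neg, map_neg] at h2
      exact abs_le.2 ⟨by change -r ≤ g (T x); linarith, h1.le⟩
    rw [hg, hG] at hr
    linarith [hH (g.comp T)]
  have hc : 0 < ‖H‖ + 1 := by positivity
  obtain ⟨y, hy⟩ := key ((‖H‖ + 1)⁻¹ • H) fun f => by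
    rw [smul_apply, smul_eq_mul, inv_mul_le_iff₀ hc]
    exact (le_abs_self _).trans (H.le_of_opNorm_le (by linarith) f)
  refine ⟨(‖H‖ + 1) • y, fun g => ?_⟩
  rw [map_smul, hy, smul_apply, smul_smul, mul_inv_cancel₀ hc.ne', one_smul]

theorem mem_closure_span_of_forall_dual {p : Submodule ℝ Y} {z : Y}
    (h : ∀ g : StrongDual ℝ Y, (∀ y ∈ p, g y = 0) → g z = 0) : z ∈ closure (p : Set Y) := by
  by_contra hz
  obtain ⟨g, r, hg, hr⟩ := geometric_hahn_banach_closed_point p.convex.closure isClosed_closure hz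
  have hr0 : 0 < r := by simpa using hg 0 (subset_closure p.zero_mem)
  have h0 : ∀ y ∈ p, g y = 0 := by
    intro y hy
    by_contra hne
    have := hg ((r / g y) • y) (subset_closure (p.smul_mem _ hy))
    rw [map_smul, smul_eq_mul, div_mul_cancel₀ _ hne] at this
    exact lt_irrefl _ this
  rw [h g h0] at hr
  exact lt_asymm hr hr0

theorem cauchySeq_apply_of_mem_closure {g : ℕ → StrongDual ℝ Y} (hg : ∀ n, ‖g n‖ ≤ 1) {s : Set Y}
    (hs : ∀ y ∈ s, CauchySeq fun n => g n y) {z : Y} (hz : z ∈ closure s) :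
    CauchySeq fun n => g n z := by
  rw [Metric.cauchySeq_iff']
  intro ε hε
  obtain ⟨y, hy, hyz⟩ := Metric.mem_closure_iff.1 hz (ε / 3) (by positivity)
  obtain ⟨N, hN⟩ := Metric.cauchySeq_iff'.1 (hs y hy) (ε / 3) (by positivity)
  refine ⟨N, fun n hn => ?_⟩
  have h1 : ∀ n, dist (g n z) (g n y) < ε / 3 := fun n => by
    rw [dist_eq_norm, ← map_sub]
    rw [dist_eq_norm] at hyz
    refine ((g n).le_opNorm _).trans_lt (lt_of_le_of_lt ?_ hyz)
    exact mul_le_of_le_one_left (norm_nonneg _) (hg n)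
  calc dist (g n z) (g N z) ≤ dist (g n z) (g n y) + dist (g n y) (g N y) + dist (g N y) (g N z) :=
        dist_triangle4 _ _ _ _
    _ < ε := by
      have := h1 N
      rw [dist_comm] at this
      linarith [h1 n, hN n hn]

/-- Absolute summability with a uniform bound lets any subfamily be summed pointwise to a bounded
functional. -/
theorem exists_hasSum_subset {h : ℕ → StrongDual ℝ X} {C : ℝ}
    (hb : ∀ x S, ∑ n ∈ S, |h n x| ≤ C * ‖x‖) (s : ℕ → Bool) :
    ∃ H : StrongDual ℝ X, ∀ x, HasSum (fun n => if s n then h n x else 0) (H x) := by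
  have hle : ∀ x n, ‖(if s n then h n x else 0 : ℝ)‖ ≤ |h n x| := by
    intro x n
    split_ifs
    · exact le_rfl
    · simp
  have habs : ∀ x, Summable fun n => |h n x| := fun x =>
    summable_of_sum_le (fun n => abs_nonneg _) (hb x)
  have hsum : ∀ x, Summable fun n => if s n then h n x else 0 := fun x =>
    Summable.of_norm_bounded (habs x) (hle x)
  let L : X →ₗ[ℝ] ℝ :=
    { toFun := fun x => ∑' n, if s n then h n x else 0
      map_add' := fun x y => by
        rw [← (hsum x).tsum_add (hsum y)]
        refine tsum_congr fun n => ?_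
        split_ifs <;> simp
      map_smul' := fun c x => by
        rw [RingHom.id_apply, smul_eq_mul, ← tsum_mul_left]
        refine tsum_congr fun n => ?_
        split_ifs <;> simp }
  refine ⟨L.mkContinuous C fun x => ?_, fun x => (hsum x).hasSum⟩
  exact (tsum_of_norm_bounded (habs x).hasSum (hle x)).trans
    ((habs x).tsum_le_of_sum_le (hb x))

/-- A weakly compact operator pairs weakly absolutely summable sequences of the bidual uniformly
to zero with bounded sequences of functionals. -/
theorem WeaklyCompactOperator.tendsto_bidual_apply {T : X →L[ℝ] Y} (hT : WeaklyCompactOperator T)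
    {h : ℕ → StrongDual ℝ (StrongDual ℝ X)} {C : ℝ}
    (hb : ∀ f S, ∑ n ∈ S, |h n f| ≤ C * ‖f‖)
    {g : ℕ → StrongDual ℝ Y} (hg : ∀ n, ‖g n‖ ≤ 1) :
    Tendsto (fun n => h n ((g n).comp T)) atTop (𝓝 0) := by
  choose y hy using fun n => hT.exists_bidual_eq (h n)
  refine tendsto_of_subseq_tendsto fun ns hns => ?_
  have hcomp : IsCompact (Set.univ.pi fun m => Set.Icc (-‖y m‖) ‖y m‖) :=
    isCompact_univ_pi fun m => isCompact_Icc
  -- Compactness of a countable product replaces the diagonal extraction: one subsequence of g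
  -- converges at every y m.
  obtain ⟨l, -, ms, hms, hl⟩ := hcomp.tendsto_subseq (x := fun k m => g (ns k) (y m)) fun k => by
    refine Set.mem_univ_pi.2 fun m => abs_le.1 (((g (ns k)).le_opNorm _).trans ?_)
    exact mul_le_of_le_one_left (norm_nonneg _) (hg _)
  refine ⟨ms, ?_⟩
  set σ : ℕ → ℕ := fun k => ns (ms k)
  have hσ : Tendsto σ atTop atTop := hns.comp hms.tendsto_atTop
  have hspan : ∀ z ∈ Submodule.span ℝ (Set.range y), CauchySeq fun k => g (σ k) z := by
    intro z hz
    suffices ∃ r, Tendsto (fun k => g (σ k) z) atTop (𝓝 r) from this.choose_spec.cauchySeq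
    induction hz using Submodule.span_induction with
    | mem z hz =>
      obtain ⟨m, rfl⟩ := hz
      exact ⟨l m, (tendsto_pi_nhds.1 hl) m⟩
    | zero => exact ⟨0, by simp⟩
    | add a b _ _ ha hb =>
      obtain ⟨r, hr⟩ := ha
      obtain ⟨t, ht⟩ := hb
      exact ⟨r + t, by simpa using hr.add ht⟩
    | smul c a _ ha =>
      obtain ⟨r, hr⟩ := ha
      exact ⟨c * r, by simpa using hr.const_mul c⟩
  refine tendsto_diagonal_of_subsetSums (a := fun k m => h m ((g (σ k)).comp T))
    (fun k => summable_of_sum_le (fun _ => abs_nonneg _) (hb _)) (fun s => ?_) hσ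
  obtain ⟨H, hH⟩ := exists_hasSum_subset hb s
  obtain ⟨z, hz⟩ := hT.exists_bidual_eq H
  -- A functional vanishing on all y n kills every term of the series defining H, hence z. So g (σ
  -- k) z, which is the subset sum over s, is Cauchy.
  have hzmem : z ∈ closure (Submodule.span ℝ (Set.range y) : Set Y) := by
    refine mem_closure_span_of_forall_dual fun f hf => ?_
    rw [hz]
    refine (hH _).unique ?_
    convert hasSum_zero using 2 with n
    rw [← hy, hf _ (Submodule.subset_span ⟨n, rfl⟩), ite_self]
  have hcs := cauchySeq_apply_of_mem_closure (fun k => hg (σ k)) hspan hzmem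
  simpa only [hz, (hH _).tsum_eq] using hcs

end Bidual

theorem exists_seq_of_not_tendstoUniformlyOn {α : Type*} {F : ℕ → α → ℝ} {A : Set α}
    (h : ¬ TendstoUniformlyOn F (fun _ => 0) atTop A) :
    ∃ ε > 0, ∃ σ : ℕ → ℕ, StrictMono σ ∧ ∃ a : ℕ → α, ∀ k, a k ∈ A ∧ ε ≤ |F (σ k) (a k)| := by
  rw [Metric.tendstoUniformlyOn_iff] at h
  push Not at h
  obtain ⟨ε, hε, h⟩ := h
  obtain ⟨σ, hσ, hσa⟩ := extraction_of_frequently_atTop h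
  choose a ha using hσa
  refine ⟨ε, hε, σ, hσ, a, fun k => ⟨(ha k).1, ?_⟩⟩
  have := (ha k).2
  rwa [dist_comm, Real.dist_0_eq_abs] at this

/-! ### The three implications -/

section Main

variable {E : Type u} [NormedAddCommGroup E] [NormedSpace ℝ E] [Lattice E]
  [IsOrderedAddMonoid E] [IsOrderedModule ℝ E] [HasSolidNorm E]

theorem DisjointlyWeaklyCompact.almostDunfordPettisSet [CompleteSpace E]
    (hE : WeakDunfordPettisProperty.{u, v} E) {A : Set E} (hA : DisjointlyWeaklyCompact A) :
    AlmostDunfordPettisSet A := by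
  refine ⟨hA.1, fun f hfd hf => ?_⟩
  by_contra hcon
  obtain ⟨ε, hε, σ, hσ, a, ha⟩ := exists_seq_of_not_tendstoUniformlyOn hcon
  obtain ⟨C, hC⟩ := isBounded_iff_forall_norm_le.1 hA.1
  have hf' : WeaklyNull fun k => |f (σ k)| := (hf.abs hfd).comp hσ.tendsto_atTop
  obtain ⟨τ, u, hτ, hud, hu, hlim⟩ := exists_disjoint_minorants (x := fun k => |a k|)
    (fun k => abs_nonneg _) ⟨C, fun k => (norm_abs_eq_norm (a k)).trans_le (hC _ (ha k).1)⟩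
    (f := fun k => |f (σ k)|) (fun k => abs_nonneg _)
    fun y => weaklyNull_iff.1 hf' (NormedSpace.inclusionInDoubleDual ℝ E y)
  have hunull : WeaklyNull u := hA.2 u
    (fun k => ⟨a (τ k), (ha _).1, by rw [abs_of_nonneg (hu k).1]; exact (hu k).2⟩) hud
  have h1 := hlim.add (hE.tendsto_apply (hf'.comp hτ.tendsto_atTop) hud hunull)
  simp only [sub_add_cancel, add_zero] at h1
  refine absurd (ge_of_tendsto' h1 fun k => ?_) hε.not_ge
  exact (ha (τ k)).2.trans (abs_apply_le_dual_abs _ _)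

theorem DisjointlyWeaklyCompact.almostLSet
    (hE : ∀ A : Set E, DisjointlyWeaklyCompact A → AlmostDunfordPettisSet A)
    {B : Set (StrongDual ℝ E)} (hB : DisjointlyWeaklyCompact B) : AlmostLSet B := by
  refine ⟨hB.1, fun x hxd hx => ?_⟩
  by_contra hcon
  obtain ⟨ε, hε, σ, hσ, f, hf⟩ := exists_seq_of_not_tendstoUniformlyOn hcon
  have hx' : ∀ k, 0 ≤ |x (σ k)| := fun k => abs_nonneg _
  choose g hg using fun k => exists_isComponent (abs_nonneg (f k)) (hx' k)
  have habs : ∀ k, |g k| = g k := fun k => abs_of_nonneg (hg k).nonneg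
  have hgd : DisjointSeq g := fun m n hmn => by
    rw [habs, habs]
    exact (hg m).inf_eq_zero (hg n) (hx' m) (hx' n) (hxd _ _ (hσ.injective.ne hmn))
  have hgnull : WeaklyNull g := hB.2 g
    (fun k => ⟨f k, (hf k).1, by rw [habs]; exact (hg k).le⟩) hgd
  -- The whole sequence |x n| serves as the test set, so uniformity covers the diagonal choice n = σ
  -- k.
  have hunif := (hE _ (disjointlyWeaklyCompact_range hxd.abs (hx.abs hxd))).2 g hgd hgnull
  obtain ⟨k, hk⟩ := (Metric.tendstoUniformlyOn_iff.1 hunif ε hε).exists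
  have h1 := hk _ ⟨σ k, rfl⟩
  rw [dist_comm, Real.dist_0_eq_abs,
    (hg k).apply_eq (hx' k) (hx' k) (k := 1) (one_nsmul _).ge] at h1
  exact ((hf k).2.trans ((abs_apply_le_dual_abs _ _).trans (le_abs_self _))).not_gt h1

variable {Y : Type*} [NormedAddCommGroup Y] [NormedSpace ℝ Y]

/-- A Φ ≥ 0 is split into components along the disjoint f n, turning the claim into one about a
pointwise absolutely summable sequence in the bidual. -/
theorem WeaklyCompactOperator.disjointlyWeaklyCompact_adjoint {T : E →L[ℝ] Y}
    (hT : WeaklyCompactOperator T) :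
    DisjointlyWeaklyCompact ((fun g : StrongDual ℝ Y => g.comp T) '' {g | ‖g‖ ≤ 1}) := by
  refine ⟨isBounded_iff_forall_norm_le.2 ⟨‖T‖, ?_⟩, fun f hf hfd =>
    weaklyNull_of_forall_nonneg fun Φ hΦ => ?_⟩
  · rintro _ ⟨g, hg, rfl⟩
    exact (g.opNorm_comp_le T).trans (mul_le_of_le_one_left (norm_nonneg _) hg)
  have hf' : ∀ n, ∃ g : StrongDual ℝ Y, ‖g‖ ≤ 1 ∧ |f n| ≤ |g.comp T| := fun n => by
    obtain ⟨_, ⟨g, hg, rfl⟩, h⟩ := hf n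
    exact ⟨g, hg, h⟩
  choose g hg hfg using hf'
  choose Q hQ using fun n => exists_isComponent hΦ (abs_nonneg (f n))
  -- A one-element family: h n is dominated by Q n and attains Q n |T' g n|, which trades the
  -- modulus for the value of one functional.
  choose h hhle hheq using fun n => exists_dual_eq_abs (ι := Unit) (hQ n).nonneg
    (x := fun _ => (g n).comp T) (fun i j hij => absurd (Subsingleton.elim i j) hij)
  have hb : ∀ ψ S, ∑ n ∈ S, |h n ψ| ≤ ‖Φ‖ * ‖ψ‖ := fun ψ S => by
    refine (Finset.sum_le_sum fun n _ => hhle n ψ).trans ?_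
    refine (sum_component_le hΦ (fun n => abs_nonneg (f n)) hfd.pairwise hQ
      (abs_nonneg ψ) S).trans ?_
    rw [← norm_abs_eq_norm ψ]
    exact (le_abs_self _).trans (Φ.le_opNorm _)
  refine squeeze_zero (fun n => dual_apply_nonneg hΦ (abs_nonneg _)) (fun n => ?_)
    (hT.tendsto_bidual_apply hb hg)
  rw [hheq n (), ← (hQ n).apply_eq (abs_nonneg _) (abs_nonneg _) (k := 1) (one_nsmul _).ge]
  exact dual_apply_mono (hQ n).nonneg (hfg n)

theorem weakDunfordPettisProperty_of_almostLSet
    (hE : ∀ B : Set (StrongDual ℝ E), DisjointlyWeaklyCompact B → AlmostLSet B) :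
    WeakDunfordPettisProperty.{u, v} E := by
  intro Y _ _ _ T hT x hxd hx
  have hunif := (hE _ hT.disjointlyWeaklyCompact_adjoint).2 x hxd hx
  rw [Metric.tendstoUniformlyOn_iff] at hunif
  refine Metric.tendsto_nhds.2 fun ε hε => ?_
  filter_upwards [hunif ε hε] with n hn
  obtain ⟨g, hg, hgx⟩ := exists_dual_vector'' ℝ (T (x n))
  have h1 := hn (g.comp T) ⟨g, hg, rfl⟩
  rw [dist_comm, Real.dist_0_eq_abs] at h1
  rw [dist_zero_right]
  have h2 : (g.comp T) (x n) = ‖T (x n)‖ := hgx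
  rwa [h2, abs_norm] at h1

end Main
end BanachLattice

open BanachLattice in
theorem theorem2p7 (E : Type u) [NormedAddCommGroup E] [NormedSpace ℝ E] [CompleteSpace E]
    [Lattice E] [IsOrderedAddMonoid E] [IsOrderedModule ℝ E] [HasSolidNorm E] :
    List.TFAE [
      WeakDunfordPettisProperty.{u, v} E,
      ∀ A : Set E, DisjointlyWeaklyCompact A → AlmostDunfordPettisSet A,
      ∀ B : Set (StrongDual ℝ E), DisjointlyWeaklyCompact B → AlmostLSet B] := by
  tfae_have 1 → 2 := fun h _ hA => hA.almostDunfordPettisSet h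
  tfae_have 2 → 3 := fun h _ hB => hB.almostLSet h
  tfae_have 3 → 1 := weakDunfordPettisProperty_of_almostLSet
  tfae_finish
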